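/- All algorithms below are randomized online algorithms: they draw a random seed, the decision at each time step is irrevocable and depends only on the seed and on the inputs revealed so far, the number of steps is not known in advance, and the input is fixed independently of the seed. **$\gamma$-OCS.** Let $E$ be a finite set. A $2$-discrete OCS on $E$ is an online algorithm that at each time step $j$ receives a multiset $A_j$ of two elements of $E$ and selects one of them. For $\gamma\in[0,1]$ it is a $\gamma$-OCS if, for every input sequence $(A_j)_j$, every $i\in E$, every $k \ge 0$ and all pairwise disjoint sets of time steps $S_1,\dots,S_k$, each consecutive (that is, of the form $\{j_1,j_1+1,\dots,j_2\}$ with $j_1<j_2$), $$\Pr\big[i\text{ is never selected at a time step in }S_1\cup\dots\cup S_k\big]\;\le\;\prod_{\ell=1}^k 2^{-c_\ell}\,(1-\gamma)^{(c_\ell-1)_+},$$ where $c_\ell=\mathrm{count}_i(S_\ell)$ is the total number of times, with multiplicity, that $i$ appears in the multisets $A_j$, $j\in S_\ell$, and $(x)_+=\max(x,0)$. We say that there is a $\gamma$-OCS if there is one on every finite set $E$. **Edge-weighted online bipartite matching (free disposal).** The algorithm is given a finite set $L$ of offline vertices. Online vertices $j=1,\dots,T$ arrive one by one; when $j$ arrives,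 its weights $w_{ij}\ge 0$, $i\in L$, are revealed ($w_{ij}=0$ means that there is no edge), and the algorithm irrevocably matches $j$ to one offline vertex or discards it. Several online vertices may be matched to the same $i\in L$, but $i$ contributes only the largest weight among them ($0$ if there is none); the weight of the output is the sum of these contributions over $i\in L$. The algorithm is $\Gamma$-competitive if, for all $T$ and all weights, its expected weight is at least $\Gamma$ times the largest weight of any assignment chosen in hindsight. **Theorem.** Let $\gamma\in(0,1)$. If there is a $\gamma$-OCS, then for every finite set $L$ of offline vertices there is a $\Gamma$-competitive algorithm for edge-weighted online bipartite matching with $$\Gamma=\frac{3+2\gamma}{6+3\gamma}.$$ -/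

import Mathlib

open MeasureTheory
open scoped NNReal

/-- A randomized online algorithm: a random seed `ω` is drawn from a probability space, and at each
time step `t = 0, 1, 2, …` an irrevocable decision is taken that may depend on the seed and on the
inputs of the steps `0, …, t` only. The number of steps is not known in advance. -/
structure OnlineAlgorithm (In Out : Type*) where
  /-- the space of random seeds -/
  Ω : Type
  [measurableSpace : MeasurableSpace Ω]
  /-- the law of the seed -/
  μ : Measure Ω
  [isProbabilityMeasure : IsProbabilityMeasure μ]
  /-- the decision at step `t`, given the inputs up to and including step `t` -/
  act : (t : ℕ) → (Fin (t + 1) → In) → Ω → Out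
  /-- the decisions are random variables (they take finitely many values below) -/
  measurableSet_act : ∀ (t : ℕ) (h : Fin (t + 1) → In) (o : Out), MeasurableSet {ω | act t h ω = o}

attribute [instance] OnlineAlgorithm.measurableSpace OnlineAlgorithm.isProbabilityMeasure

/-! ### Online correlated selection -/

/-- An `m`-discrete OCS on the ground set `E`: an online algorithm that at each step receives a
multiset of `m` elements of `E` and selects one of them. -/
structure DiscreteOCS (E : Type*) (m : ℕ) extends OnlineAlgorithm (Sym E m) E where
  act_mem : ∀ (t : ℕ) (h : Fin (t + 1) → Sym E m) (ω : Ω), act t h ω ∈ h (Fin.last t)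

namespace DiscreteOCS

/-- The winner at step `t` when the multisets `A 0, A 1, …` are fed into the OCS. -/
def winner {E : Type*} {m : ℕ} (𝒜 : DiscreteOCS E m) (A : ℕ → Sym E m) (t : ℕ) (ω : 𝒜.Ω) : E :=
  𝒜.act t (fun s : Fin (t + 1) => A s) ω

end DiscreteOCS

/-- `appearances A i S` is the total number of times, with multiplicity, that `i` appears in `A j`
for `j ∈ S`. -/
def appearances {E : Type*} [DecidableEq E] {m : ℕ} (A : ℕ → Sym E m) (i : E) (S : Finset ℕ) : ℕ :=
  ∑ j ∈ S, (A j : Multiset E).count i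

/-- A set of time steps is consecutive if it is `{j₁, …, j₂}` for some `j₁ < j₂`. -/
def IsConsecutive (S : Finset ℕ) : Prop :=
  ∃ j₁ j₂ : ℕ, j₁ < j₂ ∧ S = Finset.Icc j₁ j₂

/-- A `γ`-OCS: for every input sequence, every element `i` and all disjoint consecutive `S₁, …, Sₖ`,
the probability that `i` is never selected in `S₁ ∪ … ∪ Sₖ` is at most the product over `ℓ` of
`2 ^ (- count) * (1 - γ) ^ (count - 1)₊`, where `count` is the number of appearances of `i` in `S_ℓ`
(subtraction of natural numbers is truncated at zero). -/
def IsGammaOCS {E : Type*} [DecidableEq E] (γ : ℝ) (𝒜 : DiscreteOCS E 2) : Prop :=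
  ∀ (A : ℕ → Sym E 2) (i : E) (k : ℕ) (S : Fin k → Finset ℕ),
    (∀ ℓ, IsConsecutive (S ℓ)) → Pairwise (fun ℓ ℓ' => Disjoint (S ℓ) (S ℓ')) →
    𝒜.μ.real {ω | ∀ ℓ, ∀ j ∈ S ℓ, 𝒜.winner A j ω ≠ i} ≤
      ∏ ℓ, ((1 / 2 : ℝ) ^ appearances A i (S ℓ) * (1 - γ) ^ (appearances A i (S ℓ) - 1))

/-- There is a `γ`-OCS, that is, one for each finite ground set. -/
def GammaOCSExists (γ : ℝ) : Prop :=
  ∀ (E : Type) [Fintype E] [DecidableEq E], ∃ 𝒜 : DiscreteOCS E 2, IsGammaOCS γ 𝒜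

/-! ### Edge-weighted online bipartite matching with free disposal

An instance with offline vertices `L` and `T` online vertices is a weight matrix
`w : Fin T → L → ℝ≥0`, where `w j i` is the weight of the edge between `i ∈ L` and the online vertex
`j`, and `w j i = 0` means that there is no such edge. An assignment `x : Fin T → Option L` matches
the online vertex `j` to `i` if `x j = some i` and discards it if `x j = none`. -/

/-- The weight of an assignment under free disposal: each offline vertex contributes the largest
weight among the edges assigned to it (zero if there is none). -/
def assignmentWeight {L : Type*} [Fintype L] [DecidableEq L] {T : ℕ} (w : Fin T → L → ℝ≥0)
    (x : Fin T → Option L) : ℝ≥0 :=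
  ∑ i : L, (Finset.univ.filter (fun j : Fin T => x j = some i)).sup (fun j => w j i)

/-- The optimal weight in hindsight. -/
def optimalWeight {L : Type*} [Fintype L] [DecidableEq L] {T : ℕ} (w : Fin T → L → ℝ≥0) : ℝ≥0 :=
  (Finset.univ : Finset (Fin T → Option L)).sup (assignmentWeight w)

/-- An algorithm for edge-weighted online bipartite matching with set of offline vertices `L`: when
an online vertex arrives, the weights of its edges are revealed, and it is irrevocably matched to an
offline vertex or discarded. -/
abbrev OnlineMatchingAlgorithm (L : Type*) := OnlineAlgorithm (L → ℝ≥0) (Option L)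

namespace OnlineMatchingAlgorithm

/-- The assignment that the algorithm makes on the instance `w` with the seed `ω`. -/
def assignment {L : Type*} (ℬ : OnlineMatchingAlgorithm L) {T : ℕ} (w : Fin T → L → ℝ≥0)
    (ω : ℬ.Ω) (j : Fin T) : Option L :=
  ℬ.act j (fun s : Fin (j + 1) => w (Fin.castLE (Nat.succ_le_of_lt j.isLt) s)) ω

/-- The expected weight of the matching that the algorithm outputs on the instance `w`. -/
noncomputable def expectedWeight {L : Type*} [Fintype L] [DecidableEq L]
    (ℬ : OnlineMatchingAlgorithm L) {T : ℕ} (w : Fin T → L → ℝ≥0) : ℝ :=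
  ∫ ω, (assignmentWeight w (ℬ.assignment w ω) : ℝ) ∂ℬ.μ

/-- The integrand of `expectedWeight` is integrable, so the integral is the true expectation. -/
theorem integrable_assignmentWeight {L : Type*} [Fintype L] [DecidableEq L]
    (ℬ : OnlineMatchingAlgorithm L) {T : ℕ} (w : Fin T → L → ℝ≥0) :
    Integrable (fun ω => (assignmentWeight w (ℬ.assignment w ω) : ℝ)) ℬ.μ := by
  let _ : MeasurableSpace (Option L) := ⊤
  have hx : Measurable (fun ω => ℬ.assignment w ω) := by
    refine measurable_pi_lambda _ fun j => measurable_to_countable' fun o => ?_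
    exact ℬ.measurableSet_act _ _ o
  have hm : Measurable (fun ω => (assignmentWeight w (ℬ.assignment w ω) : ℝ)) :=
    (measurable_of_countable (fun x => (assignmentWeight w x : ℝ))).comp hx
  refine Integrable.of_bound hm.aestronglyMeasurable (optimalWeight w : ℝ) ?_
  refine Filter.Eventually.of_forall fun ω => ?_
  rw [Real.norm_of_nonneg (NNReal.coe_nonneg _)]
  exact_mod_cast Finset.le_sup (f := assignmentWeight w) (Finset.mem_univ (ℬ.assignment w ω))

/-- The algorithm is `Γ`-competitive: on every instance its expected weight is at least `Γ` times
the optimal weight in hindsight. -/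
def IsCompetitive {L : Type*} [Fintype L] [DecidableEq L] (Γ : ℝ)
    (ℬ : OnlineMatchingAlgorithm L) : Prop :=
  ∀ (T : ℕ) (w : Fin T → L → ℝ≥0), Γ * (optimalWeight w : ℝ) ≤ ℬ.expectedWeight w

end OnlineMatchingAlgorithm

/-!
The algorithm is an online primal-dual algorithm run on weight levels. By the layer cake formula,
the expected contribution of an offline vertex `i` is `∫ P[i has an edge of weight ≥ v] dv` over the
levels `v > 0`. For each vertex and level the algorithm maintains a state `(u, s)`, a deterministic
function of the weights: `u` bounds the probability that `i` has no edge of weight at least `v`, and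
`s` says whether the last pair containing `i` reached level `v`. A pair reaching the level multiplies
`u` by `1/2` if it starts a run of the OCS and by `(1-γ)/2` if it continues one; a pair below the
level interrupts the run. The maximal runs are disjoint intervals of time, so the guarantee of the
OCS is the claimed bound (`measureReal_level_not_reached_le`). Inserting an idle step after every
query makes runs of a single pair admissible too, as consecutive sets have at least two elements.

The dual variable of a level is `Γ - Γ u` outside a run and `Γ - (3Γ-1) u` during one. When an
online vertex arrives, the unspent part of the primal increase becomes its dual variable `β`, and
an action is sought which makes `β ≥ 0` and `α i + β ≥ Γ * W i` for all `i`. Each `i` has an offer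
such that `β ≥ 2 * offer` suffices for its constraint, and a pair pays at least the sum of its
two offers. So putting the two best vertices into a pair satisfies everybody else, and if
the best vertex is not satisfied then a deterministic match pays enough
(`MatchAction.exists_isGood`). All of this reduces to inequalities between states at a single level,
of which the equality `(3Γ-1)(2+γ) = 1+γ` is the critical one
(`LevelState.offer_le_surplus_afterPair`). Weak duality then gives the ratio
(`ratio_mul_optimalWeight_le`).
-/

/-! ### States of a weight level -/

/-- The target ratio `Γ = (3 + 2γ) / (6 + 3γ)`. -/
noncomputable def ratio (γ : ℝ) : ℝ := (3 + 2 * γ) / (6 + 3 * γ)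

lemma ratio_eq {γ : ℝ} (hγ : γ ∈ Set.Ioo (0 : ℝ) 1) :
    (3 * ratio γ - 1) * (2 + γ) = 1 + γ := by
  have h := hγ.1
  have h6 : 6 + 3 * γ ≠ 0 := by positivity
  unfold ratio
  field_simp
  ring

lemma ratio_ge {γ : ℝ} (hγ : γ ∈ Set.Ioo (0 : ℝ) 1) : 1 / 2 ≤ ratio γ := by
  have h := hγ.1
  rw [ratio, div_le_div_iff₀ (by norm_num) (by positivity)]
  linarith

lemma ratio_le {γ : ℝ} (hγ : γ ∈ Set.Ioo (0 : ℝ) 1) : ratio γ ≤ 5 / 9 := by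
  have h := hγ.1
  have h1 := hγ.2
  rw [ratio, div_le_div_iff₀ (by positivity) (by norm_num)]
  linarith

/-- The state `(u, s)` of an offline vertex `i` at a weight level `w`: `u` bounds the probability
that `i` has received no edge of weight at least `w`, and `s` records whether the last pair
containing `i` offered such an edge, so that a further one continues a run of the OCS. -/
abbrev LevelState := ℝ × Bool

namespace LevelState

/-- The factor by which `u` shrinks when a pair offers an edge above the level. -/
noncomputable def factor (γ : ℝ) (s : Bool) : ℝ := if s then (1 - γ) / 2 else 1 / 2

/-- The ratio of the missing dual value of a level to `u`. It is larger during a run of the OCS,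
whose next step will cover more than half of `u`. -/
noncomputable def rate (γ : ℝ) (s : Bool) : ℝ := if s then 3 * ratio γ - 1 else ratio γ

/-- The amount `Γ - α` by which the dual variable `α` of the level falls short of its target. -/
noncomputable def deficit (γ : ℝ) (x : LevelState) : ℝ := x.1 * rate γ x.2

/-- The invariant of the states that occur. A run, once started, has halved `u`. -/
def Valid (x : LevelState) : Prop := 0 ≤ x.1 ∧ x.1 ≤ 1 ∧ (x.2 = true → x.1 ≤ 1 / 2)

/-- The state after a pair containing the vertex; `hit` says that its edge reaches the level. -/
noncomputable def afterPair (γ : ℝ) (hit : Prop) [Decidable hit] (x : LevelState) : LevelState :=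
  if hit then (x.1 * factor γ x.2, true) else (x.1, false)

/-- The state after a deterministic match of the vertex. -/
noncomputable def afterSingle (hit : Prop) [Decidable hit] (x : LevelState) : LevelState :=
  if hit then (0, x.2) else x

@[fun_prop]
lemma measurable_factor (γ : ℝ) : Measurable (factor γ) := .of_discrete

@[fun_prop]
lemma measurable_rate (γ : ℝ) : Measurable (rate γ) := .of_discrete

@[fun_prop]
lemma measurable_deficit (γ : ℝ) : Measurable (deficit γ) := by
  unfold deficit
  fun_prop

lemma deficit_init (γ : ℝ) : deficit γ (1, false) = ratio γ := by simp [deficit, rate]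

lemma Valid.afterPair {γ : ℝ} (hγ : γ ∈ Set.Ioo (0 : ℝ) 1) {hit : Prop} [Decidable hit]
    {x : LevelState} (hx : x.Valid) : (x.afterPair γ hit).Valid := by
  obtain ⟨u, s⟩ := x
  obtain ⟨h0, h1, h2⟩ := hx
  have hg := hγ.1
  have hg1 := hγ.2
  unfold LevelState.afterPair Valid factor
  cases s <;> split_ifs <;> simp_all
  · linarith
  · constructor <;> nlinarith

lemma Valid.afterSingle {hit : Prop} [Decidable hit]
    {x : LevelState} (hx : x.Valid) : (x.afterSingle hit).Valid := by
  unfold LevelState.afterSingle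
  split_ifs
  · exact ⟨le_rfl, zero_le_one, fun _ => by norm_num⟩
  · exact hx

lemma Valid.deficit_nonneg {γ : ℝ} (hγ : γ ∈ Set.Ioo (0 : ℝ) 1) {x : LevelState} (hx : x.Valid) :
    0 ≤ deficit γ x := by
  have := ratio_ge hγ
  refine mul_nonneg hx.1 ?_
  unfold rate
  split_ifs <;> linarith

lemma Valid.deficit_le {γ : ℝ} (hγ : γ ∈ Set.Ioo (0 : ℝ) 1) {x : LevelState} (hx : x.Valid) :
    deficit γ x ≤ x.1 := by
  have := ratio_le hγ
  refine mul_le_of_le_one_right hx.1 ?_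
  unfold rate
  split_ifs <;> linarith

lemma Valid.deficit_le_ratio {γ : ℝ} (hγ : γ ∈ Set.Ioo (0 : ℝ) 1) {x : LevelState}
    (hx : x.Valid) : deficit γ x ≤ ratio γ := by
  have h1 := ratio_le hγ
  have h2 := ratio_ge hγ
  obtain ⟨u, s⟩ := x
  obtain ⟨hu0, hu1, hs⟩ := hx
  cases s <;> simp [deficit, rate] at * <;> nlinarith

lemma deficit_afterSingle_le {γ : ℝ} (hγ : γ ∈ Set.Ioo (0 : ℝ) 1) {hit : Prop} [Decidable hit]
    {x : LevelState} (hx : x.Valid) : deficit γ (x.afterSingle hit) ≤ deficit γ x := by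
  unfold afterSingle
  split_ifs
  · simpa [deficit] using hx.deficit_nonneg hγ
  · exact le_rfl

lemma deficit_afterPair_le {γ : ℝ} (hγ : γ ∈ Set.Ioo (0 : ℝ) 1) {hit : Prop} [Decidable hit]
    {x : LevelState} (hx : x.Valid) : deficit γ (x.afterPair γ hit) ≤ deficit γ x := by
  have h1 := ratio_le hγ
  have h2 := ratio_ge hγ
  obtain ⟨hg0, hg1⟩ := hγ
  obtain ⟨u, s⟩ := x
  obtain ⟨hu0, hu1, hs⟩ := hx
  have hpg : 0 ≤ (3 * ratio γ - 1) * (1 + γ) := by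
    apply mul_nonneg <;> linarith
  cases s <;> by_cases hit <;> simp_all [deficit, rate, factor, afterPair] <;> nlinarith

/-- The contribution of a level to the amount that the vertex can pay to the online vertex if it is
put into a pair. Above the offered weight this is negative: there the interrupted run is
compensated by raising the dual variable. -/
noncomputable def offer (γ : ℝ) (hit : Prop) [Decidable hit] (x : LevelState) : ℝ :=
  if hit then deficit γ x / 2 else -(deficit γ x - ratio γ * x.1)

/-- The primal value of a level that is not yet spent on its dual variable. -/
noncomputable def surplus (γ : ℝ) (x : LevelState) : ℝ := 1 - x.1 - (ratio γ - deficit γ x)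

/-- Twice the offer closes the gap in the dual constraint. Above the offered weight this uses that
`u ≤ 1 / 2` during a run. -/
lemma target_le_dual_add_offer {γ : ℝ} (hγ : γ ∈ Set.Ioo (0 : ℝ) 1) {hit : Prop} [Decidable hit]
    {x : LevelState} (hx : x.Valid) :
    (if hit then ratio γ else 0) ≤ (ratio γ - deficit γ x) + 2 * offer γ hit x := by
  have h1 := ratio_le hγ
  have h2 := ratio_ge hγ
  obtain ⟨u, s⟩ := x
  obtain ⟨hu0, hu1, hs⟩ := hx
  cases s <;> by_cases hit <;> simp_all [deficit, rate, offer] <;> nlinarith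

/-- The decrease of `u` pays for the dual increase and the offer. With a run in progress this is an
equality, which determines the constant `Γ`. -/
lemma offer_le_surplus_afterPair {γ : ℝ} (hγ : γ ∈ Set.Ioo (0 : ℝ) 1) {hit : Prop}
    [Decidable hit] {x : LevelState} (hx : x.Valid) :
    offer γ hit x ≤ surplus γ (x.afterPair γ hit) - surplus γ x := by
  have h3 := ratio_eq hγ
  obtain ⟨u, s⟩ := x
  obtain ⟨hu0, hu1, hs⟩ := hx
  have h4 : u * ((3 * ratio γ - 1) * (2 + γ)) = u * (1 + γ) := by rw [h3]
  cases s <;> by_cases hit <;> simp_all [deficit, rate, offer, surplus, afterPair, factor] <;>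
    nlinarith

lemma surplus_le_afterSingle {γ : ℝ} (hγ : γ ∈ Set.Ioo (0 : ℝ) 1) {hit : Prop}
    [Decidable hit] {x : LevelState} (hx : x.Valid) :
    surplus γ x ≤ surplus γ (x.afterSingle hit) := by
  have h := hx.deficit_le hγ
  unfold afterSingle
  split_ifs
  · simp only [surplus] at *
    simp [deficit] at *
    linarith
  · exact le_rfl

lemma target_le_dual_afterSingle {γ : ℝ} (hγ : γ ∈ Set.Ioo (0 : ℝ) 1) {hit : Prop}
    [Decidable hit] {x : LevelState} (hx : x.Valid) :
    (if hit then ratio γ else 0) ≤ ratio γ - deficit γ (x.afterSingle hit) := by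
  have h := hx.deficit_le_ratio hγ
  unfold afterSingle
  split_ifs
  · simp [deficit]
  · linarith

/-- Pointwise form of the comparison of a deterministic match with a pair whose better vertex is not
yet satisfied. -/
lemma two_mul_target_sub_le_surplus {γ : ℝ} (hγ : γ ∈ Set.Ioo (0 : ℝ) 1) {hit : Prop}
    [Decidable hit] {x : LevelState} (hx : x.Valid) :
    2 * ((if hit then ratio γ else 0) - (ratio γ - deficit γ (x.afterPair γ hit)) -
      offer γ hit x) ≤ surplus γ (x.afterSingle hit) - surplus γ x := by
  have h1 := ratio_le hγ
  have h2 := ratio_ge hγ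
  have h5 := hx.deficit_le_ratio hγ
  obtain ⟨hg0, hg1⟩ := hγ
  obtain ⟨u, s⟩ := x
  obtain ⟨hu0, hu1, hs⟩ := hx
  have hpg : 0 ≤ u * ((3 * ratio γ - 1) * γ) := by
    apply mul_nonneg hu0; apply mul_nonneg <;> linarith
  cases s <;> by_cases hit <;>
    simp_all [deficit, rate, offer, surplus, afterPair, afterSingle, factor] <;> nlinarith

end LevelState

/-! ### Profiles of an offline vertex -/

/-- The states of an offline vertex at all weight levels. -/
abbrev Profile := ℝ → LevelState

namespace Profile

open LevelState

/-- The profiles that occur: measurable, with valid states, and untouched at high levels. -/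
structure Admissible (f : Profile) : Prop where
  measurable : Measurable f
  valid : ∀ w, (f w).Valid
  eventually : ∃ M, ∀ w, M < w → f w = (1, false)

/-- The profile after a pair in which the vertex is offered an edge of weight `W`. -/
noncomputable def afterPair (γ W : ℝ) (f : Profile) : Profile :=
  fun w => (f w).afterPair γ (w ≤ W)

/-- The profile after a deterministic match of the vertex along an edge of weight `W`. -/
noncomputable def afterSingle (W : ℝ) (f : Profile) : Profile :=
  fun w => (f w).afterSingle (w ≤ W)

/-- The dual variable of an offline vertex. -/
noncomputable def dual (γ : ℝ) (f : Profile) : ℝ :=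
  ∫ w in Set.Ioi 0, (ratio γ - (f w).deficit γ)

/-- The primal value of an offline vertex not yet spent on its dual variable. -/
noncomputable def surplus (γ : ℝ) (f : Profile) : ℝ :=
  ∫ w in Set.Ioi 0, (f w).surplus γ

/-- What the vertex can pay when put into a pair with an edge of weight `W`. -/
noncomputable def offer (γ W : ℝ) (f : Profile) : ℝ :=
  ∫ w in Set.Ioi 0, (f w).offer γ (w ≤ W)

lemma Admissible.init : Admissible (fun _ => (1, false)) where
  measurable := measurable_const
  valid _ := ⟨zero_le_one, le_rfl, by simp⟩
  eventually := ⟨0, fun _ _ => rfl⟩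

lemma Admissible.afterPair {γ : ℝ} (hγ : γ ∈ Set.Ioo (0 : ℝ) 1) {f : Profile} (hf : f.Admissible)
    (W : ℝ) : (f.afterPair γ W).Admissible where
  measurable := by
    have h := hf.measurable
    unfold Profile.afterPair LevelState.afterPair
    exact Measurable.ite measurableSet_Iic
      ((h.fst.mul ((measurable_factor γ).comp h.snd)).prodMk measurable_const)
      (h.fst.prodMk measurable_const)
  valid w := (hf.valid w).afterPair hγ
  eventually := by
    obtain ⟨M, hM⟩ := hf.eventually
    refine ⟨max M W, fun w hw => ?_⟩
    rw [max_lt_iff] at hw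
    simp [Profile.afterPair, LevelState.afterPair, hM w hw.1, hw.2]

lemma Admissible.afterSingle {f : Profile} (hf : f.Admissible)
    (W : ℝ) : (f.afterSingle W).Admissible where
  measurable := by
    have h := hf.measurable
    unfold Profile.afterSingle LevelState.afterSingle
    exact Measurable.ite measurableSet_Iic (measurable_const.prodMk h.snd) h
  valid w := (hf.valid w).afterSingle
  eventually := by
    obtain ⟨M, hM⟩ := hf.eventually
    refine ⟨max M W, fun w hw => ?_⟩
    rw [max_lt_iff] at hw
    simp [Profile.afterSingle, LevelState.afterSingle, hM w hw.1, hw.2]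

lemma integrableOn_of_bounded_of_eventually_zero {F : ℝ → ℝ} (hF : Measurable F) (C M : ℝ)
    (hC : ∀ w, |F w| ≤ C) (hM : ∀ w, M < w → F w = 0) : IntegrableOn F (Set.Ioi 0) := by
  have h1 : IntegrableOn F (Set.Ioc 0 M) :=
    Measure.integrableOn_of_bounded (M := C) (by simp) hF.aestronglyMeasurable
      (Filter.Eventually.of_forall hC)
  refine h1.of_forall_sdiff_eq_zero measurableSet_Ioi fun w hw => hM w ?_
  by_contra h
  exact hw.2 ⟨hw.1, not_lt.1 h⟩

lemma Admissible.integrable_dual {γ : ℝ} (hγ : γ ∈ Set.Ioo (0 : ℝ) 1) {f : Profile}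
    (hf : f.Admissible) : IntegrableOn (fun w => ratio γ - (f w).deficit γ) (Set.Ioi 0) := by
  obtain ⟨M, hM⟩ := hf.eventually
  refine integrableOn_of_bounded_of_eventually_zero
    (measurable_const.sub ((measurable_deficit γ).comp hf.measurable)) 1 M
    (fun w => ?_) fun w hw => ?_
  · have h1 := ratio_le hγ
    have h2 := (hf.valid w).deficit_le_ratio hγ
    have h3 := (hf.valid w).deficit_nonneg hγ
    rw [abs_le]
    constructor <;> linarith
  · rw [hM w hw, deficit_init, sub_self]

lemma Admissible.integrable_uncovered {f : Profile} (hf : f.Admissible) :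
    IntegrableOn (fun w => 1 - (f w).1) (Set.Ioi 0) := by
  obtain ⟨M, hM⟩ := hf.eventually
  refine integrableOn_of_bounded_of_eventually_zero
    (measurable_const.sub hf.measurable.fst) 1 M (fun w => ?_) fun w hw => ?_
  · have h2 := (hf.valid w).1
    have h3 := (hf.valid w).2.1
    rw [abs_le]
    constructor <;> linarith
  · simp [hM w hw]

lemma Admissible.integrable_surplus {γ : ℝ} (hγ : γ ∈ Set.Ioo (0 : ℝ) 1) {f : Profile}
    (hf : f.Admissible) : IntegrableOn (fun w => (f w).surplus γ) (Set.Ioi 0) :=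
  hf.integrable_uncovered.sub (hf.integrable_dual hγ)

lemma Admissible.surplus_add_dual {γ : ℝ} (hγ : γ ∈ Set.Ioo (0 : ℝ) 1) {f : Profile}
    (hf : f.Admissible) :
    f.surplus γ + f.dual γ = ∫ w in Set.Ioi 0, (1 - (f w).1) := by
  unfold Profile.surplus dual
  rw [← integral_add (hf.integrable_surplus hγ) (hf.integrable_dual hγ)]
  simp [LevelState.surplus]

lemma Admissible.integrable_offer {γ : ℝ} (hγ : γ ∈ Set.Ioo (0 : ℝ) 1) {f : Profile}
    (hf : f.Admissible) (W : ℝ) :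
    IntegrableOn (fun w => (f w).offer γ (w ≤ W)) (Set.Ioi 0) := by
  obtain ⟨M, hM⟩ := hf.eventually
  have h := (measurable_deficit γ).comp hf.measurable
  refine integrableOn_of_bounded_of_eventually_zero ?_ 1 (max M W) (fun w => ?_) fun w hw => ?_
  · unfold LevelState.offer
    exact Measurable.ite measurableSet_Iic (h.div_const 2)
      (h.sub (hf.measurable.fst.const_mul (ratio γ))).neg
  · have h1 := ratio_le hγ
    have h0 := ratio_ge hγ
    have h2 := (hf.valid w).deficit_le_ratio hγ
    have h3 := (hf.valid w).deficit_nonneg hγ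
    have h4 := (hf.valid w).1
    have h5 := (hf.valid w).2.1
    rw [abs_le]
    unfold LevelState.offer
    split_ifs <;> constructor <;> nlinarith
  · rw [max_lt_iff] at hw
    simp [LevelState.offer, hM w hw.1, hw.2, deficit_init]

lemma integrable_target (γ W : ℝ) :
    IntegrableOn (fun w => if w ≤ W then ratio γ else 0) (Set.Ioi 0) := by
  refine integrableOn_of_bounded_of_eventually_zero ?_ |ratio γ| W (fun w => ?_) fun w hw => ?_
  · exact Measurable.ite measurableSet_Iic (by fun_prop) (by fun_prop)
  · split_ifs <;> simp
  · simp [hw]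

lemma integral_target (γ : ℝ) {W : ℝ} (hW : 0 ≤ W) :
    ∫ w in Set.Ioi 0, (if w ≤ W then ratio γ else 0) = ratio γ * W := by
  have h : (fun w : ℝ => if w ≤ W then ratio γ else 0) =
      (Set.Iic W).indicator (fun _ => ratio γ) := by
    ext w
    simp [Set.indicator]
  rw [h, setIntegral_indicator measurableSet_Iic, Set.Ioi_inter_Iic]
  simp [hW, mul_comm]

variable {γ : ℝ} (hγ : γ ∈ Set.Ioo (0 : ℝ) 1) {f : Profile} (hf : f.Admissible) {W : ℝ}
  (hW : 0 ≤ W)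

include hγ hf

lemma Admissible.dual_nonneg : 0 ≤ f.dual γ :=
  integral_nonneg fun w => sub_nonneg.2 ((hf.valid w).deficit_le_ratio hγ)

lemma Admissible.dual_le_afterPair : f.dual γ ≤ (f.afterPair γ W).dual γ :=
  integral_mono (hf.integrable_dual hγ) ((hf.afterPair hγ W).integrable_dual hγ)
    fun w => sub_le_sub_left (deficit_afterPair_le hγ (hf.valid w)) _

lemma Admissible.dual_le_afterSingle : f.dual γ ≤ (f.afterSingle W).dual γ :=
  integral_mono (hf.integrable_dual hγ) ((hf.afterSingle W).integrable_dual hγ)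
    fun w => sub_le_sub_left (deficit_afterSingle_le hγ (hf.valid w)) _

lemma Admissible.surplus_le_afterSingle : f.surplus γ ≤ (f.afterSingle W).surplus γ :=
  integral_mono (hf.integrable_surplus hγ) ((hf.afterSingle W).integrable_surplus hγ)
    fun w => LevelState.surplus_le_afterSingle hγ (hf.valid w)

lemma Admissible.offer_le_surplus_afterPair :
    f.offer γ W ≤ (f.afterPair γ W).surplus γ - f.surplus γ := by
  unfold offer Profile.surplus
  rw [← integral_sub ((hf.afterPair hγ W).integrable_surplus hγ) (hf.integrable_surplus hγ)]
  exact integral_mono (hf.integrable_offer hγ W)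
    (((hf.afterPair hγ W).integrable_surplus hγ).sub (hf.integrable_surplus hγ))
    fun w => LevelState.offer_le_surplus_afterPair hγ (hf.valid w)

include hW

lemma Admissible.target_le_dual_add_offer :
    ratio γ * W ≤ f.dual γ + 2 * f.offer γ W := by
  rw [← integral_target γ hW]
  unfold offer dual
  rw [← integral_const_mul, ← integral_add (hf.integrable_dual hγ)
    ((hf.integrable_offer hγ W).const_mul 2)]
  exact integral_mono (integrable_target γ W)
    ((hf.integrable_dual hγ).add ((hf.integrable_offer hγ W).const_mul 2))
    fun w => LevelState.target_le_dual_add_offer hγ (hf.valid w)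

lemma Admissible.target_le_dual_afterSingle :
    ratio γ * W ≤ (f.afterSingle W).dual γ := by
  rw [← integral_target γ hW]
  exact integral_mono (integrable_target γ W) ((hf.afterSingle W).integrable_dual hγ)
    fun w => LevelState.target_le_dual_afterSingle hγ (hf.valid w)

/-- If a pair leaves the constraint of its better vertex violated, matching that vertex
deterministically pays at least twice the offer of the other one. -/
lemma Admissible.two_mul_target_sub_le_surplus :
    2 * (ratio γ * W - (f.afterPair γ W).dual γ - f.offer γ W) ≤
      (f.afterSingle W).surplus γ - f.surplus γ := by
  have i1 := integrable_target γ W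
  have i2 := (hf.afterPair hγ W).integrable_dual hγ
  have i3 := hf.integrable_offer hγ W
  have i4 := (hf.afterSingle W).integrable_surplus hγ
  have i5 := hf.integrable_surplus hγ
  rw [← integral_target γ hW]
  unfold offer dual Profile.surplus
  rw [← integral_sub i1 i2, ← integral_sub (by exact i1.sub i2) i3, ← integral_const_mul,
    ← integral_sub i4 i5]
  exact integral_mono (((i1.sub i2).sub i3).const_mul 2) (i4.sub i5)
    fun w => LevelState.two_mul_target_sub_le_surplus hγ (hf.valid w)

end Profile

/-! ### Choosing an action -/

/-- What the algorithm can do with an online vertex: discard it, match it to a fixed offline vertex,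
or let the OCS choose between two distinct offline vertices. -/
inductive MatchAction (L : Type*)
  | discard
  | single (i : L)
  | pair (i j : L) (hij : i ≠ j)

namespace MatchAction

section Choice

variable {L : Type*} [DecidableEq L]

/-- The profiles after an action for an online vertex with weights `W`. -/
noncomputable def update (γ : ℝ) (W : L → ℝ≥0) (σ : L → Profile) : MatchAction L → L → Profile
  | discard => σ
  | single i => fun k => if k = i then (σ k).afterSingle (W k) else σ k
  | pair i j _ => fun k => if k = i ∨ k = j then (σ k).afterPair γ (W k) else σ k

lemma admissible_update {γ : ℝ} (hγ : γ ∈ Set.Ioo (0 : ℝ) 1) {W : L → ℝ≥0} {σ : L → Profile}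
    (hσ : ∀ i, (σ i).Admissible) (X : MatchAction L) (i : L) :
    (X.update γ W σ i).Admissible := by
  cases X <;> simp only [update]
  · exact hσ i
  · split_ifs
    exacts [(hσ i).afterSingle _, hσ i]
  · split_ifs
    exacts [(hσ i).afterPair hγ _, hσ i]

lemma dual_le_update {γ : ℝ} (hγ : γ ∈ Set.Ioo (0 : ℝ) 1) {W : L → ℝ≥0} {σ : L → Profile}
    (hσ : ∀ i, (σ i).Admissible) (X : MatchAction L) (i : L) :
    (σ i).dual γ ≤ (X.update γ W σ i).dual γ := by
  cases X <;> simp only [update]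
  · exact le_rfl
  · split_ifs
    exacts [(hσ i).dual_le_afterSingle hγ, le_rfl]
  · split_ifs
    exacts [(hσ i).dual_le_afterPair hγ, le_rfl]

variable [Fintype L]

/-- The dual variable of the online vertex: the primal increase that an action leaves unspent. -/
noncomputable def payment (γ : ℝ) (W : L → ℝ≥0) (σ : L → Profile) (X : MatchAction L) : ℝ :=
  ∑ i, (X.update γ W σ i).surplus γ - ∑ i, (σ i).surplus γ

/-- An action is good if it leaves a nonnegative payment that makes all dual constraints
`α i + β ≥ Γ * W i` of the online vertex hold. -/
def IsGood (γ : ℝ) (W : L → ℝ≥0) (σ : L → Profile) (X : MatchAction L) : Prop :=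
  0 ≤ X.payment γ W σ ∧ ∀ i, ratio γ * W i ≤ (X.update γ W σ i).dual γ + X.payment γ W σ

lemma payment_single (γ : ℝ) (W : L → ℝ≥0) (σ : L → Profile) (i : L) :
    (single i).payment γ W σ = ((σ i).afterSingle (W i)).surplus γ - (σ i).surplus γ := by
  rw [payment, ← Finset.sum_sub_distrib, Fintype.sum_eq_single i]
  · simp [update]
  · intro k hk
    simp [update, hk]

lemma payment_pair (γ : ℝ) (W : L → ℝ≥0) (σ : L → Profile) {i j : L} (hij : i ≠ j) :
    (pair i j hij).payment γ W σ =
      (((σ i).afterPair γ (W i)).surplus γ - (σ i).surplus γ) +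
      (((σ j).afterPair γ (W j)).surplus γ - (σ j).surplus γ) := by
  rw [payment, ← Finset.sum_sub_distrib, Fintype.sum_eq_add i j hij]
  · simp [update]
  · intro k hk
    simp [update, hk.1, hk.2]

/-- There always is a good action: if no offer is positive, discard; otherwise put the two vertices
with the best offers into a pair, unless this gives a negative payment or violates the
constraint of the better one, in which case that one is matched deterministically. -/
theorem exists_isGood {γ : ℝ} (hγ : γ ∈ Set.Ioo (0 : ℝ) 1) (W : L → ℝ≥0) {σ : L → Profile}
    (hσ : ∀ i, (σ i).Admissible) : ∃ X : MatchAction L, X.IsGood γ W σ := by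
  -- A payment of at least twice the offer of `i` satisfies the constraint of `i`.
  have hbase i := (hσ i).target_le_dual_add_offer hγ (W i).coe_nonneg
  have hdiscard (h : ∀ i, (σ i).offer γ (W i) ≤ 0) : ∃ X : MatchAction L, X.IsGood γ W σ := by
    refine ⟨discard, by simp [payment, update], fun i => ?_⟩
    have h1 := hbase i
    have h2 := h i
    simp only [payment, update, sub_self]
    linarith
  rcases isEmpty_or_nonempty L with hL | hL
  · exact hdiscard fun i => isEmptyElim i
  obtain ⟨a, ha⟩ := Finite.exists_max fun i => (σ i).offer γ (W i)
  rcases le_or_gt ((σ a).offer γ (W a)) 0 with ha0 | ha0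
  · exact hdiscard fun i => (ha i).trans ha0
  -- `single a` satisfies all constraints as soon as it pays twice every other offer.
  have hsurplus := (hσ a).surplus_le_afterSingle hγ (W := W a)
  have hsingle (h : ∀ i, i ≠ a → 2 * (σ i).offer γ (W i) ≤ (single a).payment γ W σ) :
      ∃ X : MatchAction L, X.IsGood γ W σ := by
    have h0 : 0 ≤ (single a).payment γ W σ := by
      rw [payment_single]
      linarith
    refine ⟨single a, h0, fun i => ?_⟩
    by_cases hi : i = a
    · subst hi
      have := (hσ i).target_le_dual_afterSingle hγ (W i).coe_nonneg
      simp only [update, if_true]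
      linarith
    · have h1 := hbase i
      have h2 := h i hi
      simp only [update, hi, if_false]
      linarith
  rcases (Finset.univ.erase a).eq_empty_or_nonempty with hE | hE
  · refine hsingle fun i hi => ?_
    have : i ∈ Finset.univ.erase a := by simp [hi]
    simp [hE] at this
  obtain ⟨b, hb, hbmax⟩ := Finset.exists_max_image _ (fun i => (σ i).offer γ (W i)) hE
  have hba : a ≠ b := (Finset.ne_of_mem_erase hb).symm
  have hbmax' (i : L) (hi : i ≠ a) : (σ i).offer γ (W i) ≤ (σ b).offer γ (W b) :=
    hbmax i (by simp [hi])
  have hpay := payment_single γ W σ a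
  by_cases h1 : (σ a).offer γ (W a) + (σ b).offer γ (W b) < 0
  · refine hsingle fun i hi => ?_
    have := hbmax' i hi
    linarith
  by_cases h2 : ((σ a).afterPair γ (W a)).dual γ + (σ a).offer γ (W a) + (σ b).offer γ (W b) <
      ratio γ * W a
  · refine hsingle fun i hi => ?_
    have h3 := hbmax' i hi
    have h4 := (hσ a).two_mul_target_sub_le_surplus hγ (W a).coe_nonneg
    linarith
  push Not at h1 h2
  have h3 := (hσ a).offer_le_surplus_afterPair hγ (W := W a)
  have h4 := (hσ b).offer_le_surplus_afterPair hγ (W := W b)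
  have hpay2 := payment_pair γ W σ hba
  refine ⟨pair a b hba, by linarith, fun i => ?_⟩
  by_cases hi : i = a
  · subst hi
    simp only [update, true_or, if_true]
    linarith
  · have h5 := dual_le_update hγ (W := W) hσ (pair a b hba) i
    have h6 := hbase i
    have h7 := hbmax' i hi
    have h8 := ha b
    linarith

open Classical in
/-- A good action, if there is one. -/
noncomputable def choice (γ : ℝ) (W : L → ℝ≥0) (σ : L → Profile) : MatchAction L :=
  if h : ∃ X : MatchAction L, X.IsGood γ W σ then h.choose else discard

lemma isGood_choice {γ : ℝ} (hγ : γ ∈ Set.Ioo (0 : ℝ) 1) (W : L → ℝ≥0) {σ : L → Profile}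
    (hσ : ∀ i, (σ i).Admissible) : (choice γ W σ).IsGood γ W σ := by
  have h := exists_isGood hγ W hσ
  rw [choice, dif_pos h]
  exact h.choose_spec

end Choice

end MatchAction

section Run

variable {L : Type*} [DecidableEq L] [Fintype L]

/-- The profiles before step `t` when the online vertices have the weights `w 0, w 1, …`. -/
noncomputable def profiles (γ : ℝ) (w : ℕ → L → ℝ≥0) : ℕ → L → Profile
  | 0 => fun _ _ => (1, false)
  | t + 1 => (MatchAction.choice γ (w t) (profiles γ w t)).update γ (w t) (profiles γ w t)

/-- The action at step `t`. -/
noncomputable def actionAt (γ : ℝ) (w : ℕ → L → ℝ≥0) (t : ℕ) : MatchAction L :=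
  MatchAction.choice γ (w t) (profiles γ w t)

lemma profiles_succ (γ : ℝ) (w : ℕ → L → ℝ≥0) (t : ℕ) :
    profiles γ w (t + 1) = (actionAt γ w t).update γ (w t) (profiles γ w t) := rfl

lemma admissible_profiles {γ : ℝ} (hγ : γ ∈ Set.Ioo (0 : ℝ) 1) (w : ℕ → L → ℝ≥0) (t : ℕ) (i : L) :
    (profiles γ w t i).Admissible := by
  induction t generalizing i with
  | zero => exact .init
  | succ t ih => exact MatchAction.admissible_update hγ ih _ i

lemma profiles_congr (γ : ℝ) {w w' : ℕ → L → ℝ≥0} {t : ℕ} (h : ∀ s < t, w s = w' s) :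
    profiles γ w t = profiles γ w' t := by
  induction t with
  | zero => rfl
  | succ t ih =>
    have := ih fun s hs => h s (by omega)
    rw [profiles, profiles, this, h t (by omega)]

lemma actionAt_congr (γ : ℝ) {w w' : ℕ → L → ℝ≥0} {t : ℕ} (h : ∀ s ≤ t, w s = w' s) :
    actionAt γ w t = actionAt γ w' t := by
  rw [actionAt, actionAt, h t le_rfl, profiles_congr γ fun s hs => h s hs.le]

/-! ### Weak duality -/

/-- The primal bound certified by the profiles dominates `Γ` times the optimum: the duals of the
offline vertices and the payments of the online vertices form a feasible dual solution. -/
theorem ratio_mul_optimalWeight_le {γ : ℝ} (hγ : γ ∈ Set.Ioo (0 : ℝ) 1) (w : ℕ → L → ℝ≥0)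
    (T : ℕ) : ratio γ * optimalWeight (fun (j : Fin T) i => w j i) ≤
      ∑ i, ∫ v in Set.Ioi 0, (1 - (profiles γ w T i v).1) := by
  have hadm := admissible_profiles hγ w
  let β (t : ℕ) : ℝ := (actionAt γ w t).payment γ (w t) (profiles γ w t)
  -- `β` are the payments; they telescope to the final surplus.
  have hgood t : (actionAt γ w t).IsGood γ (w t) (profiles γ w t) :=
    MatchAction.isGood_choice hγ _ (hadm t)
  have hmono i : Monotone fun t => (profiles γ w t i).dual γ :=
    monotone_nat_of_le_succ fun t => MatchAction.dual_le_update hγ (hadm t) _ i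
  have hsum : ∑ j : Fin T, β j = ∑ i, (profiles γ w T i).surplus γ := by
    rw [Fin.sum_univ_eq_sum_range β T]
    have h0 : ∑ i, (profiles γ w 0 i).surplus γ = 0 := by
      simp [profiles, Profile.surplus, LevelState.surplus, LevelState.deficit_init]
    rw [← sub_zero (∑ i, (profiles γ w T i).surplus γ), ← h0]
    exact Finset.sum_range_sub (fun t => ∑ i, (profiles γ w t i).surplus γ) T
  have hprimal : ∑ i, ∫ v in Set.Ioi 0, (1 - (profiles γ w T i v).1) =
      ∑ j : Fin T, β j + ∑ i, (profiles γ w T i).dual γ := by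
    rw [hsum, ← Finset.sum_add_distrib]
    exact Finset.sum_congr rfl fun i _ => ((hadm T i).surplus_add_dual hγ).symm
  obtain ⟨x, -, hx⟩ := Finset.exists_mem_eq_sup (Finset.univ : Finset (Fin T → Option L))
    Finset.univ_nonempty (assignmentWeight fun (j : Fin T) i => w j i)
  rw [hprimal, optimalWeight, hx, assignmentWeight, NNReal.coe_sum, Finset.mul_sum]
  have hβ : ∑ i, ∑ j : Fin T with x j = some i, β j ≤ ∑ j : Fin T, β j := by
    simp only [Finset.sum_filter]
    rw [Finset.sum_comm]
    refine Finset.sum_le_sum fun j _ => ?_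
    rcases hxj : x j with _ | k
    · simpa using (hgood j).1
    · simp
  -- The best edge of `i` in the optimal assignment is paid for by its online vertex and by `i`,
  -- whose dual variable has only grown since.
  refine le_trans ?_ (add_le_add_left hβ _)
  rw [← Finset.sum_add_distrib]
  refine Finset.sum_le_sum fun i _ => ?_
  have hβ0 (s : Finset (Fin T)) : 0 ≤ ∑ j ∈ s, β j := Finset.sum_nonneg fun j _ => (hgood j).1
  rcases (Finset.univ.filter fun j : Fin T => x j = some i).eq_empty_or_nonempty with hE | hE
  · simpa [hE] using (hadm T i).dual_nonneg hγ
  · obtain ⟨j, hj, hj'⟩ := Finset.exists_mem_eq_sup _ hE fun j : Fin T => w j i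
    rw [hj']
    have h1 := (hgood j).2 i
    have h2 := hmono i (Nat.succ_le_of_lt j.isLt)
    have h3 := Finset.single_le_sum (f := fun j : Fin T => β j) (fun j _ => (hgood j).1) hj
    rw [← profiles_succ] at h1
    simp only [β, Nat.succ_eq_add_one] at h1 h2 h3 ⊢
    linarith

end Run

/-! ### Bounds from the OCS -/

section Tracking

variable {E : Type*} [DecidableEq E] (γ : ℝ) (A : ℕ → Sym E 2) (e : E) (good : ℕ → Prop)

/-- The bound `u` is the OCS bound for some disjoint consecutive sets of steps before `n` in which
`e` appears in good steps only. -/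
def Certified (n : ℕ) (u : ℝ) : Prop :=
  ∃ (k : ℕ) (S : Fin k → Finset ℕ), (∀ ℓ, IsConsecutive (S ℓ)) ∧
    Pairwise (fun ℓ ℓ' => Disjoint (S ℓ) (S ℓ')) ∧ (∀ ℓ, ∀ j ∈ S ℓ, j < n) ∧
    (∀ ℓ, ∀ j ∈ S ℓ, e ∈ A j → good j) ∧
    u = ∏ ℓ, ((1 / 2 : ℝ) ^ appearances A e (S ℓ) * (1 - γ) ^ (appearances A e (S ℓ) - 1))

/-- The level state is justified by the steps before `2 * t`; if a run is in progress, its interval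
starts at some `2 * a` and can still be extended. -/
def Tracked (t : ℕ) : LevelState → Prop
  | (u, false) => Certified γ A e good (2 * t) u
  | (u, true) => ∃ a < t, ∃ u' c, Certified γ A e good (2 * a) u' ∧
      appearances A e (Finset.Ico (2 * a) (2 * t)) = c + 1 ∧
      (∀ j ∈ Finset.Ico (2 * a) (2 * t), e ∈ A j → good j) ∧
      u = u' * ((1 / 2) ^ (c + 1) * (1 - γ) ^ c)

variable {γ A e good}

lemma Certified.init : Certified γ A e good 0 1 :=
  ⟨0, Fin.elim0, fun ℓ => ℓ.elim0, fun ℓ => ℓ.elim0, fun ℓ => ℓ.elim0, fun ℓ => ℓ.elim0, by simp⟩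

lemma Certified.mono {n m : ℕ} (hnm : n ≤ m) {u : ℝ} (h : Certified γ A e good n u) :
    Certified γ A e good m u := by
  obtain ⟨k, S, h1, h2, h3, h4, h5⟩ := h
  exact ⟨k, S, h1, h2, fun ℓ j hj => (h3 ℓ j hj).trans_le hnm, h4, h5⟩

lemma Certified.cons {n m : ℕ} (hnm : n + 2 ≤ m) {u : ℝ} {c : ℕ} (h : Certified γ A e good n u)
    (hc : appearances A e (Finset.Ico n m) = c + 1)
    (hgood : ∀ j ∈ Finset.Ico n m, e ∈ A j → good j) :
    Certified γ A e good m (u * ((1 / 2) ^ (c + 1) * (1 - γ) ^ c)) := by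
  obtain ⟨k, S, h1, h2, h3, h4, h5⟩ := h
  have hdisj (ℓ : Fin k) : Disjoint (Finset.Ico n m) (S ℓ) :=
    Finset.disjoint_left.2 fun j hj hj' =>
      (h3 ℓ j hj').not_ge (Finset.mem_Ico.1 hj).1
  refine ⟨k + 1, Fin.cons (Finset.Ico n m) S, ?_, ?_, ?_, ?_, ?_⟩
  · refine Fin.cases ⟨n, m - 1, by omega, ?_⟩ h1
    ext j
    simp only [Fin.cons_zero, Finset.mem_Ico, Finset.mem_Icc]
    omega
  · refine Fin.cases (Fin.cases (fun h => absurd rfl h) fun ℓ _ => hdisj ℓ)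
      fun ℓ => Fin.cases (fun _ => (hdisj ℓ).symm) fun ℓ' hℓ => h2 fun hh => hℓ (congrArg Fin.succ hh)
  · exact Fin.cases (fun j hj => (Finset.mem_Ico.1 hj).2)
      fun ℓ j hj => (h3 ℓ j hj).trans_le (by omega)
  · exact Fin.cases hgood h4
  · rw [Fin.prod_univ_succ, h5, mul_comm]
    simp [hc]

lemma Tracked.certified {t : ℕ} {x : LevelState} (h : Tracked γ A e good t x) :
    Certified γ A e good (2 * t) x.1 := by
  obtain ⟨u, s⟩ := x
  cases s
  · exact h
  · obtain ⟨a, ha, u', c, h1, h2, h3, rfl⟩ := h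
    exact h1.cons (by omega) h2 h3

lemma appearances_Ico_succ {a t : ℕ} (hat : a ≤ t) :
    appearances A e (Finset.Ico (2 * a) (2 * (t + 1))) =
      appearances A e (Finset.Ico (2 * a) (2 * t)) +
        ((A (2 * t) : Multiset E).count e + (A (2 * t + 1) : Multiset E).count e) := by
  unfold appearances
  rw [show 2 * (t + 1) = 2 * t + 1 + 1 by ring, Finset.sum_Ico_succ_top (by omega),
    Finset.sum_Ico_succ_top (by omega), add_assoc]

lemma mem_Ico_succ_cases {a t j : ℕ} (hj : j ∈ Finset.Ico (2 * a) (2 * (t + 1))) :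
    j ∈ Finset.Ico (2 * a) (2 * t) ∨ j = 2 * t ∨ j = 2 * t + 1 := by
  rw [Finset.mem_Ico] at *
  omega

/-- Steps in which `e` does not appear do not interrupt a run. -/
lemma Tracked.idle {t : ℕ} {x : LevelState} (h : Tracked γ A e good t x)
    (h0 : e ∉ A (2 * t)) (h1 : e ∉ A (2 * t + 1)) : Tracked γ A e good (t + 1) x := by
  obtain ⟨u, s⟩ := x
  cases s
  · exact Certified.mono (by omega) h
  · obtain ⟨a, ha, u', c, hu', hc, hgood, rfl⟩ := h
    refine ⟨a, by omega, u', c, hu', ?_, ?_, rfl⟩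
    · rw [appearances_Ico_succ ha.le, hc, Multiset.count_eq_zero_of_notMem (by exact h0),
        Multiset.count_eq_zero_of_notMem (by exact h1)]
    · intro j hj
      rcases mem_Ico_succ_cases hj with hj | rfl | rfl
      exacts [hgood j hj, fun h => absurd h h0, fun h => absurd h h1]

lemma Tracked.afterPair {t : ℕ} {x : LevelState} (h : Tracked γ A e good t x)
    {hit : Prop} [Decidable hit] (h0 : (A (2 * t) : Multiset E).count e = 1)
    (h1 : e ∉ A (2 * t + 1)) (hgood : hit → good (2 * t)) :
    Tracked γ A e good (t + 1) (x.afterPair γ hit) := by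
  have h1' : (A (2 * t + 1) : Multiset E).count e = 0 :=
    Multiset.count_eq_zero_of_notMem (by exact h1)
  by_cases hh : hit
  · rw [LevelState.afterPair, if_pos hh]
    have hnew j (hj : j = 2 * t ∨ j = 2 * t + 1) : e ∈ A j → good j := by
      rcases hj with rfl | rfl
      exacts [fun _ => hgood hh, fun h => absurd h h1]
    obtain ⟨u, s⟩ := x
    cases s
    · refine ⟨t, by omega, u, 0, h, ?_, ?_, ?_⟩
      · rw [appearances_Ico_succ le_rfl, h0, h1']
        simp [appearances]
      · intro j hj
        rcases mem_Ico_succ_cases hj with hj | hj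
        · simp at hj
        · exact hnew j hj
      · simp [LevelState.factor]
    · obtain ⟨a, ha, u', c, hu', hc, hg, rfl⟩ := h
      refine ⟨a, by omega, u', c + 1, hu', ?_, ?_, ?_⟩
      · rw [appearances_Ico_succ ha.le, hc, h0, h1']
      · intro j hj
        rcases mem_Ico_succ_cases hj with hj | hj
        exacts [hg j hj, hnew j hj]
      · simp only [LevelState.factor, if_true]
        ring
  · rw [LevelState.afterPair, if_neg hh]
    exact h.certified.mono (by omega)

lemma Certified.measureReal_le {E : Type} [DecidableEq E] {A : ℕ → Sym E 2} {e : E}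
    {𝒜 : DiscreteOCS E 2} (h𝒜 : IsGammaOCS γ 𝒜) {n : ℕ} {u : ℝ} (h : Certified γ A e good n u) :
    𝒜.μ.real {ω | ∀ j < n, good j → 𝒜.winner A j ω ≠ e} ≤ u := by
  obtain ⟨k, S, h1, h2, h3, h4, rfl⟩ := h
  refine (measureReal_mono ?_).trans (h𝒜 A e k S h1 h2)
  intro ω hω ℓ j hj hwin
  have hmem : e ∈ A j := by
    rw [← hwin]
    exact 𝒜.act_mem j _ ω
  exact hω j (h3 ℓ j hj) (h4 ℓ j hj hmem) hwin

end Tracking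

/-! ### The algorithm -/

section Algorithm

variable {L : Type*} [Fintype L]

/-- The ground set of the OCS: a copy of the offline vertices and an idle element. -/
abbrev Ground (L : Type*) [Fintype L] : Type := Option (Fin (Fintype.card L))

/-- The element of the ground set that stands for an offline vertex. -/
noncomputable def encode (i : L) : Ground L := some (Fintype.equivFin L i)

lemma encode_injective : Function.Injective (encode : L → Ground L) :=
  (Option.some_injective _).comp (Fintype.equivFin L).injective

namespace MatchAction

/-- The multiset that is fed into the OCS; it consists of idle elements if no choice is needed. -/
noncomputable def query : MatchAction L → Sym (Ground L) 2
  | pair i j _ => ⟨{encode i, encode j}, rfl⟩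
  | _ => Sym.replicate 2 none

/-- The decision for the online vertex, given the element that the OCS selects. -/
noncomputable def output : MatchAction L → Ground L → Option L
  | discard, _ => none
  | single i, _ => some i
  | pair _ _ _, o => o.map (Fintype.equivFin L).symm

lemma encode_notMem_idle (i : L) : encode i ∉ (Sym.replicate 2 none : Sym (Ground L) 2) := by
  simp [encode, Sym.mem_replicate]

end MatchAction

variable [DecidableEq L]

/-- The input of the OCS: the query of step `t` is asked at time `2 * t`. The odd steps are idle, so
that the time of every query belongs to a consecutive set containing no other query. -/
noncomputable def ocsInput (γ : ℝ) (w : ℕ → L → ℝ≥0) (s : ℕ) : Sym (Ground L) 2 :=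
  if Even s then (actionAt γ w (s / 2)).query else Sym.replicate 2 none

lemma ocsInput_two_mul (γ : ℝ) (w : ℕ → L → ℝ≥0) (t : ℕ) :
    ocsInput γ w (2 * t) = (actionAt γ w t).query := by simp [ocsInput]

lemma encode_notMem_ocsInput_odd (γ : ℝ) (w : ℕ → L → ℝ≥0) (t : ℕ) (i : L) :
    encode i ∉ ocsInput γ w (2 * t + 1) := by
  simpa [ocsInput] using MatchAction.encode_notMem_idle i

/-- The decision at step `t` on the weights `w 0, w 1, …`. -/
noncomputable def decision (γ : ℝ) (𝒜 : DiscreteOCS (Ground L) 2) (w : ℕ → L → ℝ≥0) (t : ℕ)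
    (ω : 𝒜.Ω) : Option L :=
  (actionAt γ w t).output (𝒜.winner (ocsInput γ w) (2 * t) ω)

lemma decision_congr (γ : ℝ) (𝒜 : DiscreteOCS (Ground L) 2) {w w' : ℕ → L → ℝ≥0} {t : ℕ}
    (h : ∀ s ≤ t, w s = w' s) : decision γ 𝒜 w t = decision γ 𝒜 w' t := by
  have hin (s : Fin (2 * t + 1)) : ocsInput γ w s = ocsInput γ w' s := by
    unfold ocsInput
    rw [actionAt_congr γ fun m hm => h m (by omega)]
  ext1 ω
  simp only [decision, DiscreteOCS.winner, actionAt_congr γ h, hin]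

lemma measurableSet_decision (γ : ℝ) (𝒜 : DiscreteOCS (Ground L) 2) (w : ℕ → L → ℝ≥0) (t : ℕ)
    (o : Option L) : MeasurableSet {ω | decision γ 𝒜 w t ω = o} := by
  unfold decision
  cases actionAt γ w t
  · exact .const (none = o)
  · exact .const (some _ = o)
  · have h (x : Ground L) :
        x.map (Fintype.equivFin L).symm = o ↔ x = o.map (Fintype.equivFin L) := by
      cases x <;> cases o <;> simp [Equiv.symm_apply_eq]
    simp only [MatchAction.output, h]
    exact 𝒜.measurableSet_act _ _ _

/-- The matching algorithm based on an OCS; the unknown future weights are replaced by zeros. -/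
noncomputable def matchingAlgorithm (γ : ℝ) (𝒜 : DiscreteOCS (Ground L) 2) :
    OnlineMatchingAlgorithm L where
  Ω := 𝒜.Ω
  μ := 𝒜.μ
  act t h ω := decision γ 𝒜 (fun s => if hs : s < t + 1 then h ⟨s, hs⟩ else 0) t ω
  measurableSet_act t _ o := measurableSet_decision γ 𝒜 _ t o

/-- The probability that `i` receives no edge of weight at least `v` is at most the first component
of the state at level `v`. -/
theorem measureReal_level_not_reached_le {γ : ℝ} {𝒜 : DiscreteOCS (Ground L) 2}
    (h𝒜 : IsGammaOCS γ 𝒜) (w : ℕ → L → ℝ≥0) (i : L) (v : ℝ) (T : ℕ) :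
    𝒜.μ.real {ω | ∀ t < T, decision γ 𝒜 w t ω = some i → (w t i : ℝ) < v} ≤
      (profiles γ w T i v).1 := by
  -- Only pair steps are certified, as the selected element is ignored in the other steps.
  let good (j : ℕ) : Prop := v ≤ w (j / 2) i ∧ 
    ∃ X : {p : L × L // p.1 ≠ p.2}, actionAt γ w (j / 2) = .pair X.1.1 X.1.2 X.2
  -- After a deterministic match at the level the bound is zero and the event is impossible; until
  -- then the state is tracked by intervals of the OCS.
  have key (t : ℕ) : ((∃ m < t, actionAt γ w m = .single i ∧ v ≤ w m i) ∧
      (profiles γ w t i v).1 = 0) ∨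
      Tracked γ (ocsInput γ w) (encode i) good t (profiles γ w t i v) := by
    induction t with
    | zero => exact .inr Certified.init
    | succ t ih =>
      have hodd := encode_notMem_ocsInput_odd γ w t i
      have heven := ocsInput_two_mul γ w t
      rw [profiles_succ]
      rcases ih with ⟨⟨m, hm, hm'⟩, hzero⟩ | htr
      · refine .inl ⟨⟨m, by omega, hm'⟩, ?_⟩
        cases actionAt γ w t <;> simp only [MatchAction.update]
        · exact hzero
        · split_ifs
          · simp only [Profile.afterSingle, LevelState.afterSingle]
            split_ifs <;> simp [hzero]
          · exact hzero
        · split_ifs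
          · simp only [Profile.afterPair, LevelState.afterPair]
            split_ifs <;> simp [hzero]
          · exact hzero
      · cases hX : actionAt γ w t with
        | discard =>
          rw [hX] at heven
          exact .inr (htr.idle (heven ▸ MatchAction.encode_notMem_idle i) hodd)
        | single k =>
          rw [hX] at heven
          have hidle := htr.idle (heven ▸ MatchAction.encode_notMem_idle i) hodd
          by_cases hk : i = k
          · by_cases hv : v ≤ w t i
            · refine .inl ⟨⟨t, by omega, hk ▸ hX, hv⟩, ?_⟩
              simp [MatchAction.update, hk, Profile.afterSingle, LevelState.afterSingle, hk ▸ hv]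
            · right
              simpa [MatchAction.update, hk, Profile.afterSingle, LevelState.afterSingle,
                hk ▸ hv] using hidle
          · right
            simpa [MatchAction.update, hk] using hidle
        | pair a b hab =>
          rw [hX] at heven
          right
          by_cases hk : i = a ∨ i = b
          · have hcount : (ocsInput γ w (2 * t) : Multiset (Ground L)).count (encode i) = 1 := by
              rw [heven]
              have hab' := encode_injective.ne hab
              change Multiset.count (encode i) {encode a, encode b} = 1
              rcases hk with rfl | rfl
              · simp [hab']
              · simp [Multiset.insert_eq_cons, hab'.symm]
            have := htr.afterPair (hit := v ≤ w t i) hcount hodd fun hv =>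
              ⟨by simpa using hv, ⟨(a, b), hab⟩, by simpa using hX⟩
            simpa only [MatchAction.update, if_pos hk, Profile.afterPair] using this
          · rw [not_or] at hk
            have hmem : encode i ∉ ocsInput γ w (2 * t) := by
              rw [heven]
              change encode i ∉ ({encode a, encode b} : Multiset (Ground L))
              simp [encode_injective.eq_iff, hk.1, hk.2]
            simpa [MatchAction.update, hk.1, hk.2] using htr.idle hmem hodd
  rcases key T with ⟨⟨m, hm, hX, hv⟩, hzero⟩ | htr
  · rw [hzero]
    refine le_of_eq ?_
    convert measureReal_empty (μ := 𝒜.μ)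
    refine Set.eq_empty_of_forall_notMem fun ω hω => ?_
    exact (hω m hm (by simp [decision, hX, MatchAction.output])).not_ge hv
  · refine (measureReal_mono ?_).trans (htr.certified.measureReal_le h𝒜)
    intro ω hω j hj hgood hwin
    obtain ⟨hv, X, hX⟩ := hgood
    have hj2 : Even j := by
      by_contra hodd
      obtain ⟨t, rfl⟩ := Nat.not_even_iff_odd.1 hodd
      refine encode_notMem_ocsInput_odd γ w t i ?_
      rw [← hwin]
      exact 𝒜.act_mem _ _ ω
    obtain ⟨t, rfl⟩ := even_iff_exists_two_mul.1 hj2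
    rw [Nat.mul_div_cancel_left t two_pos] at hv hX
    refine (hω t (by omega) ?_).not_ge hv
    simp [decision, hX, hwin, MatchAction.output, encode]

/-- The expected weight is at least the primal bound certified by the profiles. -/
theorem le_expectedWeight_matchingAlgorithm {γ : ℝ} (hγ : γ ∈ Set.Ioo (0 : ℝ) 1)
    {𝒜 : DiscreteOCS (Ground L) 2} (h𝒜 : IsGammaOCS γ 𝒜) (w : ℕ → L → ℝ≥0) (T : ℕ) :
    ∑ i, ∫ v in Set.Ioi 0, (1 - (profiles γ w T i v).1) ≤
      (matchingAlgorithm γ 𝒜).expectedWeight (fun (j : Fin T) i => w j i) := by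
  let W : Fin T → L → ℝ≥0 := fun j i => w j i
  let x (ω : 𝒜.Ω) (j : Fin T) : Option L := decision γ 𝒜 w j ω
  have hx (ω : 𝒜.Ω) : (matchingAlgorithm γ 𝒜).assignment W ω = x ω := by
    ext1 j
    refine congrFun (decision_congr γ 𝒜 fun s hs => ?_) ω
    rw [dif_pos (Nat.lt_succ_of_le hs)]
    rfl
  let best (i : L) (y : Fin T → Option L) : ℝ≥0 :=
    (Finset.univ.filter fun j : Fin T => y j = some i).sup fun j => W j i
  have hmeas i : Measurable fun ω => (best i (x ω) : ℝ) := by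
    let _ : MeasurableSpace (Option L) := ⊤
    have hxm : Measurable x := by
      refine measurable_pi_lambda _ fun j => measurable_to_countable' fun o => ?_
      exact measurableSet_decision γ 𝒜 w j o
    exact (measurable_of_countable fun y => (best i y : ℝ)).comp hxm
  obtain ⟨C, hC⟩ : ∃ C : ℝ, ∀ i y, (best i y : ℝ) ≤ C := by
    obtain ⟨C, hC⟩ := (Set.finite_range fun p : L × (Fin T → Option L) =>
      (best p.1 p.2 : ℝ)).bddAbove
    exact ⟨C, fun i y => hC ⟨(i, y), rfl⟩⟩
  have hint i : Integrable (fun ω => (best i (x ω) : ℝ)) 𝒜.μ := by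
    refine Integrable.of_bound (hmeas i).aestronglyMeasurable C (.of_forall fun ω => ?_)
    rw [Real.norm_of_nonneg (NNReal.coe_nonneg _)]
    exact hC i _
  have hweight : (matchingAlgorithm γ 𝒜).expectedWeight W = ∑ i, ∫ ω, (best i (x ω) : ℝ) ∂𝒜.μ := by
    rw [← integral_finsetSum _ fun i _ => hint i]
    unfold OnlineMatchingAlgorithm.expectedWeight
    refine integral_congr_ae (.of_forall fun ω => ?_)
    exact (congrArg (fun y => (assignmentWeight W y : ℝ)) (hx ω)).trans (NNReal.coe_sum _ _)
  change _ ≤ (matchingAlgorithm γ 𝒜).expectedWeight W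
  rw [hweight]
  refine Finset.sum_le_sum fun i _ => ?_
  -- Layer cake formula: the expected best weight is the integral over the levels `v` of the
  -- probability that level `v` is reached.
  rw [(hint i).integral_eq_integral_meas_le (.of_forall fun ω => NNReal.coe_nonneg _)]
  have hanti : Antitone fun v : ℝ => 𝒜.μ.real {ω | v ≤ (best i (x ω) : ℝ)} :=
    fun v v' hv => measureReal_mono fun ω hω => hv.trans hω
  refine setIntegral_mono_on (admissible_profiles hγ w T i).integrable_uncovered ?_
    measurableSet_Ioi fun v hv => ?_
  · refine Profile.integrableOn_of_bounded_of_eventually_zero hanti.measurable 1 C (fun v => ?_)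
      fun v hv => ?_
    · rw [abs_of_nonneg measureReal_nonneg]
      exact measureReal_le_one
    · convert measureReal_empty (μ := 𝒜.μ)
      exact Set.eq_empty_of_forall_notMem fun ω hω => ((hC i _).trans_lt hv).not_ge hω
  · have hcompl : {ω | v ≤ (best i (x ω) : ℝ)}ᶜ ⊆
        {ω | ∀ t < T, decision γ 𝒜 w t ω = some i → (w t i : ℝ) < v} := by
      intro ω hω t ht hdec
      have h1 : w t i ≤ best i (x ω) :=
        Finset.le_sup (f := fun j : Fin T => W j i) (b := ⟨t, ht⟩) (by simpa [x] using hdec)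
      exact lt_of_le_of_lt (by exact_mod_cast h1) (not_le.1 hω)
    have h1 := (measureReal_mono hcompl).trans (measureReal_level_not_reached_le h𝒜 w i v T)
    rw [probReal_compl_eq_one_sub (measurableSet_le measurable_const (hmeas i))] at h1
    linarith

end Algorithm

theorem mainTheorem5 (γ : ℝ) (hγ : γ ∈ Set.Ioo (0 : ℝ) 1) (hOCS : GammaOCSExists γ)
    (L : Type*) [Fintype L] [DecidableEq L] :
    ∃ ℬ : OnlineMatchingAlgorithm L,
      OnlineMatchingAlgorithm.IsCompetitive ((3 + 2 * γ) / (6 + 3 * γ)) ℬ := by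
  obtain ⟨𝒜, h𝒜⟩ := hOCS (Ground L)
  refine ⟨matchingAlgorithm γ 𝒜, fun T W => ?_⟩
  let w (t : ℕ) : L → ℝ≥0 := if ht : t < T then W ⟨t, ht⟩ else 0
  have hw : (fun (j : Fin T) i => w j i) = W := by
    ext j i
    simp [w]
  have h1 := ratio_mul_optimalWeight_le hγ w T
  have h2 := le_expectedWeight_matchingAlgorithm hγ h𝒜 w T
  rw [hw] at h1 h2
  exact h1.trans h2
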